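/- Let $k$ be a field and let $d \ge 1$ be an integer. A standard graded $k$-algebra is a graded $k$-algebra $R=\bigoplus_{n\ge 0}R_n$ generated as a $k$-algebra by finitely many forms of degree one; let $\mathfrak m$ denote its maximal graded ideal. For a finitely generated graded $R$-module $M \neq 0$, the Castelnuovo–Mumford regularity of $M$ is $$\operatorname{reg} M=\max\{\,i+j \mid i\ge 0,\ j\in\mathbb Z,\ H^i_{\mathfrak m}(M)_j\ne 0\,\},$$ where $H^i_{\mathfrak m}(M)$ is the $i$-th local cohomology module of $M$ with respect to $\mathfrak m$. Let $\{a_n\}_{n\ge 1}$ be a sequence of non-negative integers. Then the following are equivalent: 1. there exist a standard graded $k$-algebra $R$ and a proper ideal $I\subset R$ generated by forms of degree $d$, with $I^n\neq 0$ for all $n\ge 1$ and $\dim R/I=0$, such that $\{a_n\}$ is the defect sequence of the function $\operatorname{reg} R/I^n$, i.e. $a_n=\operatorname{reg} R/I^n-dn+1$ for all $n\ge 1$; 2. $\{a_n\}$ is weakly decreasing, i.e. $a_{n+1}\le a_n$ for all $n\ge 1$, and $a_n-a_{n+1}\le d$ for all $n\ge 1$. -/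

import Mathlib

namespace CMReg

section Cech

variable {R : Type*} [CommRing R] (M : Type*) [AddCommGroup M] [Module R M]
  {r : ℕ} (x : Fin r → R)

/-- The localization `M_{x_S}` of `M` at the powers of `x_S = ∏_{l ∈ S} x_l`. -/
abbrev Loc (S : Finset (Fin r)) : Type _ :=
  LocalizedModule (Submonoid.powers (∏ l ∈ S, x l)) M

theorem isUnit_of_subset {S T : Finset (Fin r)} (h : S ⊆ T)
    (y : Submonoid.powers (∏ l ∈ S, x l)) :
    IsUnit (algebraMap R (Module.End R (Loc M x T)) (y : R)) := by
  obtain ⟨_, n, rfl⟩ := y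
  have hT : IsUnit (algebraMap R (Module.End R (Loc M x T)) (∏ l ∈ T, x l)) :=
    IsLocalizedModule.map_units (LocalizedModule.mkLinearMap _ M)
      (⟨∏ l ∈ T, x l, Submonoid.mem_powers _⟩ : Submonoid.powers (∏ l ∈ T, x l))
  have hprod : (∏ l ∈ S, x l) * ∏ l ∈ T \ S, x l = ∏ l ∈ T, x l := by
    rw [mul_comm]; exact Finset.prod_sdiff h
  have hT' := congrArg (algebraMap R (Module.End R (Loc M x T))) hprod
  rw [map_mul] at hT'
  rw [← hT'] at hT
  have hc : Commute (algebraMap R (Module.End R (Loc M x T)) (∏ l ∈ S, x l))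
      (algebraMap R (Module.End R (Loc M x T)) (∏ l ∈ T \ S, x l)) :=
    Algebra.commutes _ _
  simpa using (hc.isUnit_mul_iff.mp hT).1.pow n

/-- For `S ⊆ T`, the canonical map `M_{x_S} → M_{x_T}`. -/
noncomputable def restrict {S T : Finset (Fin r)} (h : S ⊆ T) :
    Loc M x S →ₗ[R] Loc M x T :=
  LocalizedModule.lift _ (LocalizedModule.mkLinearMap _ M) (isUnit_of_subset M x h)

/-- The total Čech module `∏_S M_{x_S}`; the `p`-cochains are the families supported on the
sets `S` with `p` elements. -/
abbrev TotalCochain : Type _ := (S : Finset (Fin r)) → Loc M x S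

/-- The Čech differential
`(δ c)_T = ∑_{l ∈ T} (-1)^{#{l' ∈ T, l' < l}} c_{T \ {l}}|_{M_{x_T}}`. -/
noncomputable def cechDiff : TotalCochain M x →+ TotalCochain M x where
  toFun c T := ∑ l ∈ T, (-1 : R) ^ (T.filter (· < l)).card •
    restrict M x (T.erase_subset l) (c (T.erase l))
  map_zero' := by ext T; simp
  map_add' b c := by ext T; simp [smul_add, Finset.sum_add_distrib]

variable {M} (ℳ : ℤ → AddSubgroup M)

/-- The degree `j` part of `M_{x_S}`, for `M = ⨁ ℳ j` graded and all `x l` of degree one: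
it consists of the fractions `m / x_S ^ t` with `m` of degree `j + t * #S`. -/
def locDegree (S : Finset (Fin r)) (j : ℤ) : AddSubgroup (Loc M x S) :=
  AddSubgroup.closure {z | ∃ (t : ℕ) (m : M), m ∈ ℳ (j + t * S.card) ∧
    z = LocalizedModule.mk m ⟨(∏ l ∈ S, x l) ^ t, pow_mem (Submonoid.mem_powers _) t⟩}

/-- The Čech `p`-cochains of internal degree `j` (zero if `p < 0`). -/
def cochains (p j : ℤ) : AddSubgroup (TotalCochain M x) where
  carrier := {c | (∀ S, c S ∈ locDegree x ℳ S j) ∧ ∀ S, (S.card : ℤ) ≠ p → c S = 0}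
  zero_mem' := ⟨fun _ => zero_mem _, fun _ _ => rfl⟩
  add_mem' ha hb := ⟨fun S => add_mem (ha.1 S) (hb.1 S),
    fun S h => by simp [ha.2 S h, hb.2 S h]⟩
  neg_mem' ha := ⟨fun S => neg_mem (ha.1 S), fun S h => by simp [ha.2 S h]⟩

/-- Čech `p`-cocycles of internal degree `j`. -/
noncomputable def cocycles (p j : ℤ) : AddSubgroup (TotalCochain M x) :=
  cochains x ℳ p j ⊓ (cechDiff M x).ker

/-- Čech `p`-coboundaries of internal degree `j`. -/
noncomputable def coboundaries (p j : ℤ) : AddSubgroup (TotalCochain M x) :=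
  (cochains x ℳ (p - 1) j).map (cechDiff M x)

/-- The degree `j` part of the `p`-th local cohomology module of the graded module
`M = ⨁ ℳ j` with respect to the ideal generated by the degree one elements `x l`,
as the `p`-th cohomology of the degree `j` part of the Čech complex
`0 → M → ∏ M_{x_l} → ∏ M_{x_l x_l'} → ⋯`. -/
abbrev LocalCohomology (p j : ℤ) : Type _ :=
  cocycles x ℳ p j ⧸ (coboundaries x ℳ p j).addSubgroupOf (cocycles x ℳ p j)

end Cech

section Graded

variable {k R : Type*} [Field k] [CommRing R] [Algebra k R] (𝒜 : ℕ → Submodule k R)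

/-- `x 0, …, x (r - 1)` are forms of degree one that generate `R` as a `k`-algebra; they then
generate the maximal graded ideal of `R`. -/
def IsLinearGenerators {r : ℕ} (x : Fin r → R) : Prop :=
  (∀ l, x l ∈ 𝒜 1) ∧ Algebra.adjoin k (Set.range x) = ⊤

/-- The graded `k`-algebra `R = ⨁ 𝒜 n` is standard graded: it is generated by finitely many
forms of degree one. -/
def IsStandardGraded : Prop :=
  ∃ (r : ℕ) (x : Fin r → R), IsLinearGenerators 𝒜 x

/-- For a graded module `M = ⨁ ℳ j` over the standard graded algebra `R = ⨁ 𝒜 n` with maximal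
graded ideal `𝔪`: the Castelnuovo-Mumford regularity of `M` is the integer `ρ`, that is,
`ρ = max {p + j | H^p_𝔪(M)_j ≠ 0}`, where `H^p_𝔪(M)` may be computed from any finite system of
linear generators of `R`. (No integer `ρ` qualifies when `M = 0`, where the regularity is `-∞`.) -/
def HasRegularity {M : Type*} [AddCommGroup M] [Module R M] (ℳ : ℤ → AddSubgroup M)
    (ρ : ℤ) : Prop :=
  ∀ (r : ℕ) (x : Fin r → R), IsLinearGenerators 𝒜 x →
    IsGreatest {s : ℤ | ∃ (p : ℕ) (j : ℤ), Nontrivial (LocalCohomology x ℳ p j) ∧ s = p + j} ρ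

/-- The grading of `R ⧸ J` by the images of the graded pieces of `R` (zero in negative degrees);
it is a grading when `J` is a graded ideal. -/
def quotientGrading (J : Ideal R) : ℤ → AddSubgroup (R ⧸ J)
  | Int.ofNat n => (𝒜 n).toAddSubgroup.map (Ideal.Quotient.mk J).toAddMonoidHom
  | Int.negSucc _ => ⊥

/-- `I` is generated by forms of degree `d`. -/
def GeneratedInDegree (I : Ideal R) (d : ℕ) : Prop :=
  ∃ s : Set R, s ⊆ 𝒜 d ∧ I = Ideal.span s

/-- `{a n}` for `n ≥ 1` is the defect sequence of the function `n ↦ reg R/I^n`, for `I` generated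
in degree `d`: `a n = reg R/I^n - d n + 1` for all `n ≥ 1`. -/
def IsDefectSequence (I : Ideal R) (d : ℕ) (a : ℕ → ℕ) : Prop :=
  ∀ n : ℕ, 1 ≤ n → HasRegularity 𝒜 (quotientGrading 𝒜 (I ^ n)) ((d : ℤ) * n + a n - 1)

end Graded

end CMReg

universe u

namespace CMReg

/-! ### Local cohomology of locally nilpotent modules -/

section Cech

variable {R : Type*} [CommRing R] {M : Type*} [AddCommGroup M] [Module R M]
  {r : ℕ} {x : Fin r → R}

/-! Since `dim R/I = 0`, every linear form has a power in `I ^ n`. The Čech complex of `R/I^n` is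
then concentrated in cohomological degree zero, and `reg R/I^n` is the top degree in which `R/I^n`
is nonzero (`hasRegularity_quotient_iff`). So `a n` is the least `b` with `𝔪 ^ (b + d * n) ≤ I ^ n`.

With this description the gap bound `a n ≤ a (n + 1) + d` is just `I ^ (n + 1) ≤ I ^ n`.
Monotonicity (`IsStandardGraded.subset_pow_succ`) rests on generation in one degree: if `𝔪 ^ (b + d
* n) ≤ I ^ n`, then even `𝔪 ^ (b + d * n) ≤ I ^ n * 𝔪 ^ b`. Multiplying by `𝔪 ^ d` and trading all
but one factor `I` for `𝔪 ^ d` leads into `I * 𝔪 ^ (b + d * n) ≤ I ^ (n + 1)`.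

Conversely, take `k[X₀, X₁]` modulo the monomials outside a staircase and `I = (X₀ ^ d)`. A basis of
`R/I^n` is the part of the staircase with `i < d * n`; the two conditions on `a` say that its corner
`(d * n - 1, a n)` has the largest total degree (`isGreatest_defectStaircase`). -/

theorem loc_subsingleton (hx : ∀ l (m : M), ∃ N : ℕ, x l ^ N • m = 0)
    {S : Finset (Fin r)} (hS : S.Nonempty) : Subsingleton (Loc M x S) := by
  refine subsingleton_of_forall_eq 0 fun z => ?_
  induction z using LocalizedModule.induction_on with
  | _ m s =>
    obtain ⟨l, hl⟩ := hS
    obtain ⟨N, hN⟩ := hx l m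
    rw [← LocalizedModule.zero_mk s, LocalizedModule.mk_eq]
    -- A single `l ∈ S` suffices: `x l ^ N` divides the `N`-th power of the product.
    refine ⟨⟨(∏ l ∈ S, x l) ^ N, pow_mem (Submonoid.mem_powers _) N⟩, ?_⟩
    have h0 : (∏ l ∈ S, x l) ^ N • m = 0 := by
      rw [← Finset.mul_prod_erase S x hl, mul_pow, mul_comm, mul_smul, hN, smul_zero]
    change (∏ l ∈ S, x l) ^ N • (s : R) • m = (∏ l ∈ S, x l) ^ N • (s : R) • (0 : M)
    rw [smul_zero, smul_zero, smul_comm, h0, smul_zero]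

theorem mk_empty_eq_zero_iff (m : M) (s : Submonoid.powers (∏ l ∈ (∅ : Finset (Fin r)), x l)) :
    (LocalizedModule.mk m s : Loc M x ∅) = 0 ↔ m = 0 := by
  have h1 : ∀ u : Submonoid.powers (∏ l ∈ (∅ : Finset (Fin r)), x l), (u : R) = 1 := by
    rintro ⟨_, n, rfl⟩
    simp
  rw [← LocalizedModule.zero_mk s, LocalizedModule.mk_eq]
  constructor
  · rintro ⟨u, hu⟩
    change (u : R) • (s : R) • m = (u : R) • (s : R) • (0 : M) at hu
    simpa [h1] using hu
  · rintro rfl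
    exact ⟨1, rfl⟩

variable (ℳ : ℤ → AddSubgroup M)

theorem locDegree_empty_eq_bot_iff (j : ℤ) :
    locDegree x ℳ ∅ j = ⊥ ↔ ℳ j = ⊥ := by
  rw [locDegree, AddSubgroup.closure_eq_bot_iff]
  constructor
  · intro h
    rw [eq_bot_iff]
    intro m hm
    exact (mk_empty_eq_zero_iff m _).1 (h ⟨0, m, by simpa using hm, rfl⟩)
  · rintro h _ ⟨t, m, hm, rfl⟩
    have hm' : m ∈ ℳ j := by simpa using hm
    rw [h, AddSubgroup.mem_bot] at hm'
    exact (mk_empty_eq_zero_iff m _).2 hm'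

/-- The local cohomology of a module on which every `x l` acts locally nilpotently is the module
itself, placed in cohomological degree zero. -/
theorem nontrivial_localCohomology_iff (hx : ∀ l (m : M), ∃ N : ℕ, x l ^ N • m = 0)
    (p : ℕ) (j : ℤ) :
    Nontrivial (LocalCohomology x ℳ p j) ↔ p = 0 ∧ ℳ j ≠ ⊥ := by
  have hsub : ∀ c : TotalCochain M x, c ∅ = 0 → c = 0 := by
    intro c hc
    funext S
    rcases S.eq_empty_or_nonempty with rfl | hS
    · exact hc
    · exact @Subsingleton.elim _ (loc_subsingleton hx hS) _ _
  -- Only the component at `∅` can be nonzero, and there the differential is an empty sum.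
  have hdiff : ∀ c, cechDiff M x c = 0 := fun c => hsub _ (by simp [cechDiff])
  have hcob : coboundaries x ℳ p j = ⊥ := by
    rw [eq_bot_iff]
    rintro _ ⟨c, -, rfl⟩
    exact hdiff c
  have hcoc : cocycles x ℳ p j = cochains x ℳ p j := by
    rw [cocycles, inf_eq_left]
    exact fun c _ => hdiff c
  rw [← not_iff_not, not_nontrivial_iff_subsingleton, QuotientAddGroup.subsingleton_iff, hcob,
    hcoc, AddSubgroup.addSubgroupOf_eq_top, le_bot_iff, not_and, not_not,
    ← locDegree_empty_eq_bot_iff (x := x) ℳ]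
  constructor
  · rintro h rfl
    rw [eq_bot_iff]
    intro z hz
    let c : TotalCochain M x := Pi.single ∅ z
    have hc : c ∈ cochains x ℳ (0 : ℕ) j := by
      refine ⟨fun S => ?_, fun S hS => Pi.single_eq_of_ne (by rintro rfl; exact hS (by simp)) z⟩
      by_cases hS : S = ∅
      · subst hS
        simpa [c] using hz
      · simp [c, hS, zero_mem]
    rw [h, AddSubgroup.mem_bot] at hc
    simpa [c] using congrFun hc ∅
  · intro h
    rw [eq_bot_iff]
    intro c hc
    refine hsub c ?_
    by_cases hp : p = 0
    · have := hc.1 ∅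
      rwa [h hp, AddSubgroup.mem_bot] at this
    · exact hc.2 ∅ (by exact_mod_cast Ne.symm hp)

end Cech

/-! ### Regularity as top degree -/

section Graded

variable {k R : Type*} [Field k] [CommRing R] [Algebra k R] (𝒜 : ℕ → Submodule k R)

theorem quotientGrading_natCast_eq_bot_iff (J : Ideal R) (n : ℕ) :
    quotientGrading 𝒜 J n = ⊥ ↔ (𝒜 n : Set R) ⊆ J := by
  change (𝒜 n).toAddSubgroup.map (Ideal.Quotient.mk J).toAddMonoidHom = ⊥ ↔ _
  rw [AddSubgroup.map_eq_bot_iff]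
  refine forall₂_congr fun y _ => ?_
  exact Ideal.Quotient.eq_zero_iff_mem

/-- The regularity of a quotient `R ⧸ J` of finite length is its top degree. -/
theorem hasRegularity_quotient_iff (hst : IsStandardGraded 𝒜) (J : Ideal R)
    (hJ : ∀ y ∈ 𝒜 1, ∃ N : ℕ, y ^ N ∈ J) (ρ : ℤ) :
    HasRegularity 𝒜 (quotientGrading 𝒜 J) ρ ↔
      IsGreatest {s : ℤ | ∃ n : ℕ, ¬ (𝒜 n : Set R) ⊆ J ∧ s = n} ρ := by
  have key : ∀ (r : ℕ) (x : Fin r → R), IsLinearGenerators 𝒜 x →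
      {s : ℤ | ∃ (p : ℕ) (j : ℤ),
        Nontrivial (LocalCohomology x (quotientGrading 𝒜 J) p j) ∧ s = p + j} =
      {s : ℤ | ∃ n : ℕ, ¬ (𝒜 n : Set R) ⊆ J ∧ s = n} := by
    intro r x hx
    have hnil : ∀ l (m : R ⧸ J), ∃ N : ℕ, x l ^ N • m = 0 := by
      intro l m
      obtain ⟨N, hN⟩ := hJ _ (hx.1 l)
      refine ⟨N, ?_⟩
      rw [Algebra.smul_def, Ideal.Quotient.algebraMap_eq, Ideal.Quotient.eq_zero_iff_mem.2 hN,
        zero_mul]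
    ext s
    constructor
    · rintro ⟨p, j, h, rfl⟩
      obtain ⟨rfl, hj⟩ := (nontrivial_localCohomology_iff _ hnil p j).1 h
      rcases j with n | n
      · exact ⟨n, fun h => hj ((quotientGrading_natCast_eq_bot_iff 𝒜 J n).2 h), by simp⟩
      · exact absurd rfl hj
    · rintro ⟨n, h, rfl⟩
      exact ⟨0, n, (nontrivial_localCohomology_iff _ hnil 0 n).2
        ⟨rfl, fun h' => h ((quotientGrading_natCast_eq_bot_iff 𝒜 J n).1 h')⟩, by simp⟩
  constructor
  · intro h
    obtain ⟨r, x, hx⟩ := hst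
    rw [← key r x hx]
    exact h r x hx
  · intro h r x hx
    rw [key r x hx]
    exact h

end Graded

end CMReg

namespace CMReg

/-! ### Necessity of the two conditions -/

section Forward

open DirectSum
open scoped Pointwise

variable {k R : Type*} [Field k] [CommRing R] [Algebra k R] {𝒜 : ℕ → Submodule k R}
  [GradedAlgebra 𝒜]

theorem pow_subset_of_subset {s : Set R} {d : ℕ} (hs : s ⊆ (𝒜 d : Set R)) (n : ℕ) :
    s ^ n ⊆ (𝒜 (d * n) : Set R) := by
  induction n with
  | zero => simpa using SetLike.GradedOne.one_mem (A := 𝒜)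
  | succ n ih =>
    rw [pow_succ, Set.mul_subset_iff]
    exact fun y hy z hz => SetLike.GradedMul.mul_mem (ih hy) (hs hz)

theorem GeneratedInDegree.pow {I : Ideal R} {d : ℕ} (hI : GeneratedInDegree 𝒜 I d) (n : ℕ) :
    GeneratedInDegree 𝒜 (I ^ n) (d * n) := by
  obtain ⟨s, hs, rfl⟩ := hI
  exact ⟨s ^ n, pow_subset_of_subset hs n, Submodule.span_pow s n⟩

theorem GeneratedInDegree.isHomogeneous {I : Ideal R} {d : ℕ} (hI : GeneratedInDegree 𝒜 I d) :
    I.IsHomogeneous 𝒜 := by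
  obtain ⟨s, hs, rfl⟩ := hI
  exact Ideal.homogeneous_span 𝒜 s fun y hy => ⟨d, hs hy⟩

/-- A form of degree `e + a` in an ideal generated in degree `e` is a combination of generators
with coefficients of degree `a`. -/
theorem GeneratedInDegree.mem_mul_span {J : Ideal R} {e : ℕ} (hJ : GeneratedInDegree 𝒜 J e)
    {a : ℕ} {y : R} (hy : y ∈ 𝒜 (a + e)) (hyJ : y ∈ J) :
    y ∈ J * Ideal.span (𝒜 a : Set R) := by
  obtain ⟨s, hs, rfl⟩ := hJ
  -- The extra multiplier `t` absorbs ring coefficients, so that the span induction closes.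
  have key : ∀ y ∈ Ideal.span s, ∀ t : R,
      ((decompose 𝒜 (t * y) (a + e) : 𝒜 (a + e)) : R) ∈
        Ideal.span s * Ideal.span (𝒜 a : Set R) := by
    intro y hy
    induction hy using Submodule.span_induction with
    | mem y hy =>
      intro t
      rw [coe_decompose_mul_add_of_right_mem 𝒜 (hs hy), mul_comm]
      exact Ideal.mul_mem_mul (Ideal.subset_span (SetLike.coe_mem _)) (Ideal.subset_span hy)
    | zero => intro t; simp
    | add y z _ _ hy hz =>
      intro t
      rw [mul_add, decompose_add]
      exact add_mem (hy t) (hz t)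
    | smul u y _ hy =>
      intro t
      rw [smul_eq_mul, ← mul_assoc]
      exact hy _
  have h := key y hyJ 1
  rwa [one_mul, decompose_of_mem_same 𝒜 hy] at h

theorem IsStandardGraded.le_pow (hst : IsStandardGraded 𝒜) (n : ℕ) : 𝒜 n ≤ 𝒜 1 ^ n := by
  obtain ⟨r, x, hx, htop⟩ := hst
  -- Stated for all components of all elements, since sums and products do not stay homogeneous.
  have key : ∀ y ∈ Algebra.adjoin k (Set.range x), ∀ n,
      ((decompose 𝒜 y n : 𝒜 n) : R) ∈ 𝒜 1 ^ n := by
    intro y hy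
    induction hy using Algebra.adjoin_induction with
    | mem y hy =>
      intro n
      obtain ⟨l, rfl⟩ := hy
      by_cases hn : n = 1
      · subst hn
        rw [pow_one]
        exact SetLike.coe_mem _
      · rw [decompose_of_mem_ne 𝒜 (hx l) (Ne.symm hn)]
        exact zero_mem _
    | algebraMap c =>
      intro n
      have hc : algebraMap k R c ∈ 𝒜 0 := SetLike.algebraMap_mem_graded 𝒜 c
      by_cases hn : n = 0
      · subst hn
        rw [decompose_of_mem_same 𝒜 hc, pow_zero]
        exact Submodule.algebraMap_mem c
      · rw [decompose_of_mem_ne 𝒜 hc (Ne.symm hn)]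
        exact zero_mem _
    | add y z _ _ hy hz =>
      intro n
      rw [decompose_add]
      exact add_mem (hy n) (hz n)
    | mul y z _ _ hy hz =>
      intro n
      rw [decompose_mul, coe_mul_apply_eq_sum_antidiagonal]
      refine sum_mem fun ij hij => ?_
      rw [← Finset.HasAntidiagonal.mem_antidiagonal.1 hij, pow_add]
      exact Submodule.mul_mem_mul (hy _) (hz _)
  intro y hy
  have h := key y (htop ▸ Algebra.mem_top) n
  rwa [decompose_of_mem_same 𝒜 hy] at h

theorem IsStandardGraded.span_eq (hst : IsStandardGraded 𝒜) (n : ℕ) :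
    Ideal.span (𝒜 n : Set R) = Ideal.span (𝒜 1 : Set R) ^ n := by
  refine le_antisymm (Ideal.span_le.2 fun y hy => ?_) ?_
  · have hle : ∀ m : ℕ, 𝒜 1 ^ m ≤ (Ideal.span (𝒜 1 : Set R) ^ m).restrictScalars k := by
      intro m
      induction m with
      | zero => simp
      | succ m ih =>
        rw [pow_succ, Submodule.mul_le]
        intro u hu v hv
        rw [Submodule.restrictScalars_mem, pow_succ]
        exact Ideal.mul_mem_mul (ih hu) (Ideal.subset_span hv)
    exact hle n (hst.le_pow n hy)
  · rw [Ideal.span, Submodule.span_pow]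
    refine Submodule.span_mono ?_
    simpa using pow_subset_of_subset (𝒜 := 𝒜) (s := (𝒜 1 : Set R)) (d := 1) le_rfl n

theorem IsStandardGraded.subset_iff (hst : IsStandardGraded 𝒜) (n : ℕ) (J : Ideal R) :
    (𝒜 n : Set R) ⊆ J ↔ Ideal.span (𝒜 1 : Set R) ^ n ≤ J := by
  rw [← hst.span_eq, Ideal.span_le]

/-- Forms of degree `a + e` in `J` need only coefficients of degree `a`, and these span `𝔪 ^ a`. -/
theorem IsStandardGraded.span_pow_le_mul (hst : IsStandardGraded 𝒜) {J : Ideal R} {e a : ℕ}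
    (hJ : GeneratedInDegree 𝒜 J e) (h : Ideal.span (𝒜 1 : Set R) ^ (a + e) ≤ J) :
    Ideal.span (𝒜 1 : Set R) ^ (a + e) ≤ J * Ideal.span (𝒜 1 : Set R) ^ a := by
  rw [← hst.subset_iff] at h ⊢
  rw [← hst.span_eq]
  exact fun y hy => hJ.mem_mul_span hy (h hy)

theorem GeneratedInDegree.le_pow {I : Ideal R} {d : ℕ} (hI : GeneratedInDegree 𝒜 I d)
    (hst : IsStandardGraded 𝒜) : I ≤ Ideal.span (𝒜 1 : Set R) ^ d := by
  obtain ⟨s, hs, rfl⟩ := hI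
  rw [← hst.span_eq]
  exact Ideal.span_mono hs

theorem IsStandardGraded.subset_pow_succ (hst : IsStandardGraded 𝒜) {I : Ideal R} {d : ℕ}
    (hI : GeneratedInDegree 𝒜 I d) {n a : ℕ} (hn : 1 ≤ n)
    (h : (𝒜 (a + d * n) : Set R) ⊆ (I ^ n : Ideal R)) :
    (𝒜 (a + d * (n + 1)) : Set R) ⊆ (I ^ (n + 1) : Ideal R) := by
  -- As `n ≥ 1`, one factor `I` can be kept aside while the others are enlarged.
  obtain ⟨n, rfl⟩ : ∃ m, n = m + 1 := ⟨n - 1, by omega⟩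
  rw [hst.subset_iff] at h ⊢
  set 𝔪 := Ideal.span (𝒜 1 : Set R)
  calc 𝔪 ^ (a + d * (n + 1 + 1)) = 𝔪 ^ (a + d * (n + 1)) * 𝔪 ^ d := by
        rw [← pow_add]; ring_nf
    _ ≤ I ^ (n + 1) * 𝔪 ^ a * 𝔪 ^ d :=
        Ideal.mul_mono_left (hst.span_pow_le_mul (hI.pow (n + 1)) h)
    _ = I * (I ^ n * 𝔪 ^ (a + d)) := by ring
    -- This inclusion restores the exponent of the hypothesis, which can then be applied a second
    -- time.
    _ ≤ I * ((𝔪 ^ d) ^ n * 𝔪 ^ (a + d)) :=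
        Ideal.mul_mono_right (Ideal.mul_mono_left (Ideal.pow_right_mono (hI.le_pow hst) n))
    _ = I * 𝔪 ^ (a + d * (n + 1)) := by rw [← pow_mul, ← pow_add]; ring_nf
    _ ≤ I * I ^ (n + 1) := Ideal.mul_mono_right h
    _ = I ^ (n + 1 + 1) := by ring

/-- `R/I` is finite over `k`, so `y` satisfies a monic equation modulo `I`; its leading term is a
homogeneous component and hence lies in the homogeneous ideal `I`. -/
theorem exists_pow_mem_of_ringKrullDim_eq_zero (hst : IsStandardGraded 𝒜) {I : Ideal R}
    (hI : I.IsHomogeneous 𝒜) (hdim : ringKrullDim (R ⧸ I) = 0) {y : R} (hy : y ∈ 𝒜 1) :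
    ∃ N : ℕ, y ^ N ∈ I := by
  obtain ⟨r, x, hx, htop⟩ := hst
  have : Algebra.FiniteType k R :=
    ⟨⟨(Set.finite_range x).toFinset, by simpa using htop⟩⟩
  have : Nontrivial (R ⧸ I) := by
    by_contra h
    rw [not_nontrivial_iff_subsingleton] at h
    rw [ringKrullDim_eq_bot_of_subsingleton] at hdim
    exact absurd hdim (by simp)
  have : Module.Finite k (R ⧸ I) :=
    (Module.finite_iff_krullDimLE_zero k _).2 (ringKrullDimZero_iff_ringKrullDim_eq_zero.2 hdim)
  obtain ⟨p, hp, hpy⟩ := Algebra.IsIntegral.isIntegral (R := k) (Ideal.Quotient.mk I y)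
  refine ⟨p.natDegree, ?_⟩
  have hmem : Polynomial.aeval y p ∈ I := by
    rw [← Ideal.Quotient.eq_zero_iff_mem, ← Ideal.Quotient.mkₐ_eq_mk k,
      ← Polynomial.aeval_algHom_apply]
    exact hpy
  have hcomp := hI p.natDegree hmem
  have hpow : ∀ i, y ^ i ∈ 𝒜 i := fun i => by
    simpa using SetLike.pow_mem_graded i hy
  have hsum : ((decompose 𝒜 (Polynomial.aeval y p) p.natDegree : 𝒜 p.natDegree) : R) =
      y ^ p.natDegree := by
    rw [Polynomial.aeval_eq_sum_range, decompose_sum, DFinsupp.finsetSum_apply,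
      AddSubmonoidClass.coe_finsetSum, Finset.sum_eq_single p.natDegree]
    · rw [decompose_of_mem_same 𝒜 (Submodule.smul_mem _ _ (hpow _)), hp.coeff_natDegree, one_smul]
    · intro i _ hi
      exact decompose_of_mem_ne 𝒜 (Submodule.smul_mem _ _ (hpow _)) hi
    · simp
  rwa [hsum] at hcomp

theorem exists_pow_mem_pow_of_ringKrullDim_eq_zero (hst : IsStandardGraded 𝒜) {I : Ideal R}
    (hI : I.IsHomogeneous 𝒜) (hdim : ringKrullDim (R ⧸ I) = 0) (n : ℕ) {y : R} (hy : y ∈ 𝒜 1) :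
    ∃ N : ℕ, y ^ N ∈ I ^ n := by
  obtain ⟨N, hN⟩ := exists_pow_mem_of_ringKrullDim_eq_zero hst hI hdim hy
  exact ⟨N * n, by rw [pow_mul]; exact Ideal.pow_mem_pow hN n⟩

omit [GradedAlgebra 𝒜] in
-- The quotient is generated by finitely many nilpotent, hence integral, elements, so it is finite
-- over `k`.
theorem IsLinearGenerators.ringKrullDim_eq_zero {r : ℕ} {x : Fin r → R}
    (hx : IsLinearGenerators 𝒜 x) {I : Ideal R} (hI : I ≠ ⊤) (hnil : ∀ l, ∃ N : ℕ, x l ^ N ∈ I) :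
    ringKrullDim (R ⧸ I) = 0 := by
  have : Nontrivial (R ⧸ I) := Ideal.Quotient.nontrivial_iff.2 hI
  have hint : ∀ y ∈ Ideal.Quotient.mkₐ k I '' Set.range x, IsIntegral k y := by
    rintro _ ⟨_, ⟨l, rfl⟩, rfl⟩
    obtain ⟨N, hN⟩ := hnil l
    refine ⟨Polynomial.X ^ N, Polynomial.monic_X_pow N, ?_⟩
    rw [Polynomial.eval₂_X_pow, ← map_pow]
    exact Ideal.Quotient.eq_zero_iff_mem.2 hN
  have hfg := fg_adjoin_of_finite ((Set.finite_range x).image _) hint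
  rw [← AlgHom.map_adjoin, hx.2, Algebra.map_top,
    (AlgHom.range_eq_top _).2 (Ideal.Quotient.mkₐ_surjective k I)] at hfg
  have : Module.Finite k (R ⧸ I) := ⟨hfg⟩
  exact ringKrullDimZero_iff_ringKrullDim_eq_zero.1
    ((Module.finite_iff_krullDimLE_zero k _).1 this)

theorem IsDefectSequence.decreasing_and_le (hst : IsStandardGraded 𝒜) {I : Ideal R} {d : ℕ}
    (hd : 1 ≤ d) (hI : GeneratedInDegree 𝒜 I d) (hdim : ringKrullDim (R ⧸ I) = 0) {a : ℕ → ℕ}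
    (ha : IsDefectSequence 𝒜 I d a) {n : ℕ} (hn : 1 ≤ n) :
    a (n + 1) ≤ a n ∧ a n ≤ a (n + 1) + d := by
  -- `a n` is the least `b` with `𝔪 ^ (b + d * n) ≤ I ^ n`; the top degree of `R/I^n` is `a n + d *
  -- n - 1`.
  have hreg : ∀ n : ℕ, 1 ≤ n → ∀ b : ℕ,
      (𝒜 (b + d * n) : Set R) ⊆ (I ^ n : Ideal R) ↔ a n ≤ b := by
    intro n hn b
    have hdn : 1 ≤ d * n := Nat.mul_pos hd hn
    have h := (hasRegularity_quotient_iff 𝒜 hst (I ^ n)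
      (fun _ => exists_pow_mem_pow_of_ringKrullDim_eq_zero hst hI.isHomogeneous hdim n) _).1 (ha n hn)
    obtain ⟨⟨m, hm, hmeq⟩, hub⟩ := h
    have hm' : m + 1 = a n + d * n := by
      zify; linarith
    constructor
    · intro hb
      by_contra hlt
      refine hm ?_
      rw [hst.subset_iff] at hb ⊢
      exact (Ideal.pow_le_pow_right (by omega)).trans hb
    · intro hb
      by_contra hsub
      have := hub ⟨_, hsub, rfl⟩
      push_cast at this
      zify at hb
      linarith
  constructor
  · rw [← hreg (n + 1) (by omega)]
    exact hst.subset_pow_succ hI hn ((hreg n hn _).2 le_rfl)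
  · rw [← hreg n hn, show a (n + 1) + d + d * n = a (n + 1) + d * (n + 1) by ring]
    exact ((hreg (n + 1) (by omega) _).2 le_rfl).trans (Ideal.pow_le_pow_right (Nat.le_succ n))

end Forward

end CMReg

namespace CMReg

/-! ### Grading on a quotient by a homogeneous ideal -/

section Quotient

open DirectSum

variable {k P : Type*} [Field k] [CommRing P] [Algebra k P] (𝒜 : ℕ → Submodule k P)
  (J : Ideal P)

/-- The graded pieces of the quotient of a graded algebra. -/
def quotientPiece (n : ℕ) : Submodule k (P ⧸ J) :=
  (𝒜 n).map (Ideal.Quotient.mkₐ k J).toLinearMap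

theorem mk_mem_quotientPiece {n : ℕ} {p : P} (hp : p ∈ 𝒜 n) :
    Ideal.Quotient.mk J p ∈ quotientPiece 𝒜 J n :=
  ⟨p, hp, rfl⟩

/-- The quotient map on the graded pieces. -/
def quotientPieceMap (n : ℕ) : 𝒜 n →+ quotientPiece 𝒜 J n where
  toFun p := ⟨Ideal.Quotient.mk J p, mk_mem_quotientPiece 𝒜 J p.2⟩
  map_zero' := Subtype.ext (map_zero _)
  map_add' _ _ := Subtype.ext (map_add _ _ _)

variable [GradedAlgebra 𝒜]

/-- The map sending an element to the classes of its homogeneous components. -/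
noncomputable def toQuotientPieces : P →+ ⨁ n, quotientPiece 𝒜 J n :=
  (DirectSum.map (quotientPieceMap 𝒜 J)).comp (decomposeAddEquiv 𝒜).toAddMonoidHom

theorem toQuotientPieces_coe {n : ℕ} (p : 𝒜 n) :
    toQuotientPieces 𝒜 J p =
      DirectSum.of (fun n => quotientPiece 𝒜 J n) n (quotientPieceMap 𝒜 J n p) := by
  change DirectSum.map (quotientPieceMap 𝒜 J) (decompose 𝒜 (p : P)) = _
  rw [decompose_coe, DirectSum.map_of]

variable {J}

theorem toQuotientPieces_eq_zero (hJ : J.IsHomogeneous 𝒜) {p : P} (hp : p ∈ J) :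
    toQuotientPieces 𝒜 J p = 0 :=
  DFinsupp.ext fun n => Subtype.ext (Ideal.Quotient.eq_zero_iff_mem.2 (hJ n hp))

/-- The decomposition of an element of the quotient into homogeneous components. -/
noncomputable def quotientDecompose (hJ : J.IsHomogeneous 𝒜) :
    P ⧸ J →+ ⨁ n, quotientPiece 𝒜 J n :=
  QuotientAddGroup.lift J.toAddSubgroup (toQuotientPieces 𝒜 J)
    fun _ hp => toQuotientPieces_eq_zero 𝒜 hJ hp

theorem quotientDecompose_mk (hJ : J.IsHomogeneous 𝒜) (p : P) :
    quotientDecompose 𝒜 hJ (Ideal.Quotient.mk J p) = toQuotientPieces 𝒜 J p :=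
  rfl

/-- The quotient of a graded algebra by a homogeneous ideal is graded. -/
noncomputable abbrev quotientGradedAlgebra (hJ : J.IsHomogeneous 𝒜) :
    GradedAlgebra (quotientPiece 𝒜 J) where
  one_mem := mk_mem_quotientPiece 𝒜 J (SetLike.GradedOne.one_mem (A := 𝒜))
  mul_mem := by
    rintro i j _ _ ⟨p, hp, rfl⟩ ⟨q, hq, rfl⟩
    exact mk_mem_quotientPiece 𝒜 J (SetLike.GradedMul.mul_mem hp hq)
  decompose' := quotientDecompose 𝒜 hJ
  left_inv y := by
    obtain ⟨p, rfl⟩ := Ideal.Quotient.mk_surjective y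
    rw [quotientDecompose_mk]
    induction p using DirectSum.Decomposition.inductionOn 𝒜 with
    | zero => simp
    | homogeneous m =>
      rw [toQuotientPieces_coe, DirectSum.coeAddMonoidHom_of]
      rfl
    | add p q hp hq => rw [map_add, map_add, map_add, hp, hq]
  right_inv y := by
    induction y using DirectSum.induction_on with
    | zero => rw [map_zero, map_zero]
    | of i y =>
      obtain ⟨_, p, hp, rfl⟩ := y
      rw [DirectSum.coeAddMonoidHom_of]
      exact toQuotientPieces_coe 𝒜 J (⟨p, hp⟩ : 𝒜 i)
    | add y z hy hz => rw [map_add, map_add, hy, hz]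

end Quotient

/-! ### Monomial algebras of staircases -/

section Staircase

open MvPolynomial

attribute [local instance] MvPolynomial.gradedAlgebra

variable (k : Type*) [Field k] (N : ℕ → ℕ → Prop)

/-- The ideal of `k[X₀, X₁]` spanned by the monomials outside the staircase `N`. -/
noncomputable def staircaseIdeal : Ideal (MvPolynomial (Fin 2) k) :=
  Ideal.span ((fun e => monomial e (1 : k)) '' {e | ¬ N (e 0) (e 1)})

theorem staircaseIdeal_isHomogeneous :
    (staircaseIdeal k N).IsHomogeneous (homogeneousSubmodule (Fin 2) k) := by
  refine Ideal.homogeneous_span _ _ ?_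
  rintro _ ⟨e, -, rfl⟩
  exact ⟨e.degree, isHomogeneous_monomial _ rfl⟩

/-- The monomial algebra with basis the staircase `N`. -/
noncomputable abbrev StaircaseAlgebra := MvPolynomial (Fin 2) k ⧸ staircaseIdeal k N

/-- The grading of the staircase algebra by total degree. -/
noncomputable abbrev staircaseGrading : ℕ → Submodule k (StaircaseAlgebra k N) :=
  quotientPiece (homogeneousSubmodule (Fin 2) k) (staircaseIdeal k N)

/-- The classes of the two variables. -/
noncomputable def staircaseVar (l : Fin 2) : StaircaseAlgebra k N :=
  Ideal.Quotient.mk (staircaseIdeal k N) (X l)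

theorem staircaseVar_isLinearGenerators :
    IsLinearGenerators (staircaseGrading k N) (staircaseVar k N) := by
  refine ⟨fun l => mk_mem_quotientPiece _ _ (isHomogeneous_X k l), ?_⟩
  have h : Set.range (staircaseVar k N) =
      Ideal.Quotient.mkₐ k (staircaseIdeal k N) '' Set.range X := by
    rw [← Set.range_comp]
    rfl
  rw [h, ← AlgHom.map_adjoin, adjoin_range_X, Algebra.map_top, AlgHom.range_eq_top]
  exact Ideal.Quotient.mkₐ_surjective k _

variable {N}

/-- Upstairs this is membership in a monomial ideal, that is, divisibility by `X₀ ^ m` or by a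
monomial outside `N`; as `N` is closed downwards, the latter puts `e` itself outside `N`. -/
theorem mk_monomial_mem_span_pow_iff (hN : ∀ {i j i' j'}, N i j → i' ≤ i → j' ≤ j → N i' j')
    (m : ℕ) (e : Fin 2 →₀ ℕ) :
    Ideal.Quotient.mk (staircaseIdeal k N) (monomial e 1) ∈
      Ideal.span {staircaseVar k N 0 ^ m} ↔ (N (e 0) (e 1) → m ≤ e 0) := by
  have h : Ideal.span {staircaseVar k N 0 ^ m} =
      (Ideal.span {(X 0 : MvPolynomial (Fin 2) k) ^ m}).map
        (Ideal.Quotient.mk (staircaseIdeal k N)) := by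
    rw [Ideal.map_span, Set.image_singleton, map_pow]
    rfl
  have h' : Ideal.span {(X 0 : MvPolynomial (Fin 2) k) ^ m} ⊔ staircaseIdeal k N =
      Ideal.span ((fun e => monomial e (1 : k)) ''
        ({Finsupp.single 0 m} ∪ {e | ¬ N (e 0) (e 1)})) := by
    rw [Set.image_union, Ideal.span_union, Set.image_singleton, X_pow_eq_monomial]
    rfl
  rw [h, Ideal.mem_quotient_iff_mem_sup, h', mem_ideal_span_monomial_image]
  classical
  rw [support_monomial, if_neg one_ne_zero]
  simp only [Finset.mem_singleton, forall_eq]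
  constructor
  · rintro ⟨e', he' | he', hle⟩ hNe
    · rw [Set.mem_singleton_iff] at he'
      subst he'
      simpa using hle 0
    · exact absurd (hN hNe (hle 0) (hle 1)) he'
  · intro hm
    by_cases hNe : N (e 0) (e 1)
    · exact ⟨_, Or.inl rfl, by simpa using hm hNe⟩
    · exact ⟨e, Or.inr hNe, le_rfl⟩

theorem staircaseGrading_subset_iff (hN : ∀ {i j i' j'}, N i j → i' ≤ i → j' ≤ j → N i' j')
    (m n : ℕ) :
    (staircaseGrading k N n : Set (StaircaseAlgebra k N)) ⊆
      Ideal.span {staircaseVar k N 0 ^ m} ↔ ∀ i j, i + j = n → N i j → m ≤ i := by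
  constructor
  · intro h i j hij hNij
    let e : Fin 2 →₀ ℕ := Finsupp.single 0 i + Finsupp.single 1 j
    have h0 : e 0 = i := by simp [e]
    have h1 : e 1 = j := by simp [e]
    have hdeg : e.degree = n := by
      rw [Finsupp.degree_eq_sum, Fin.sum_univ_two, h0, h1, hij]
    have := (mk_monomial_mem_span_pow_iff k hN m e).1
      (h (mk_mem_quotientPiece _ _ (isHomogeneous_monomial 1 hdeg)))
    rw [h0, h1] at this
    exact this hNij
  · rintro h _ ⟨p, hp, rfl⟩
    change Ideal.Quotient.mk (staircaseIdeal k N) p ∈ _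
    rw [p.as_sum, map_sum]
    refine sum_mem fun e he => ?_
    rw [← mul_one (p.coeff e), ← C_mul_monomial, map_mul]
    refine Ideal.mul_mem_left _ _ ((mk_monomial_mem_span_pow_iff k hN m e).2 ?_)
    refine h _ _ ?_
    rw [← Fin.sum_univ_two (fun i => e i), ← Finsupp.degree_eq_sum]
    have := hp (mem_support_iff.1 he)
    rw [Finsupp.degree_eq_weight_one]
    exact this

end Staircase

/-! ### Combinatorics of the staircase -/

section Converse

/-- The staircase of the monomials `X₀ ^ i * X₁ ^ j` with `j = 0`, or `i < d * n` for some
`n ≥ 1` with `j ≤ a n`. -/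
def defectStaircase (d : ℕ) (a : ℕ → ℕ) (i j : ℕ) : Prop :=
  j = 0 ∨ ∃ n, 1 ≤ n ∧ i < d * n ∧ j ≤ a n

variable {d : ℕ} {a : ℕ → ℕ}

theorem defectStaircase.mono {i j i' j' : ℕ} (h : defectStaircase d a i j) (hi : i' ≤ i)
    (hj : j' ≤ j) : defectStaircase d a i' j' := by
  rcases h with rfl | ⟨n, hn, h1, h2⟩
  · exact Or.inl (Nat.le_zero.1 hj)
  · exact Or.inr ⟨n, hn, hi.trans_lt h1, hj.trans h2⟩

theorem le_add_mul_of_le_add (h : ∀ n, 1 ≤ n → a n ≤ a (n + 1) + d) {m : ℕ} (hm : 1 ≤ m)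
    (t : ℕ) : a m ≤ a (m + t) + d * t := by
  induction t with
  | zero => simp
  | succ t ih =>
    have := h (m + t) (by omega)
    rw [mul_add, ← add_assoc m t 1]
    omega

theorem le_of_succ_le (h : ∀ n, 1 ≤ n → a (n + 1) ≤ a n) {n m : ℕ} (hn : 1 ≤ n) (hnm : n ≤ m) :
    a m ≤ a n := by
  induction m, hnm using Nat.le_induction with
  | base => exact le_rfl
  | succ m hnm ih => exact (h m (hn.trans hnm)).trans ih

/-- The largest total degree of a point of the staircase to the left of `d * n`. -/
theorem isGreatest_defectStaircase (hd : 1 ≤ d) (h1 : ∀ n, 1 ≤ n → a (n + 1) ≤ a n)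
    (h2 : ∀ n, 1 ≤ n → a n ≤ a (n + 1) + d) {n : ℕ} (hn : 1 ≤ n) :
    IsGreatest {s | ∃ i j, defectStaircase d a i j ∧ i < d * n ∧ i + j = s}
      (d * n - 1 + a n) := by
  have hdn : 1 ≤ d * n := Nat.mul_pos hd hn
  refine ⟨⟨d * n - 1, a n, Or.inr ⟨n, hn, by omega, le_rfl⟩, by omega, rfl⟩, ?_⟩
  rintro _ ⟨i, j, rfl | ⟨m, hm, him, hjm⟩, hi, rfl⟩
  · omega
  -- Steps to the right of `d * n` are no higher than `a n`; those to the left gain at most `d * t`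
  -- in height but lose `d * t` in width.
  · rcases le_total n m with hnm | hmn
    · have := le_of_succ_le h1 hn hnm
      omega
    · obtain ⟨t, rfl⟩ := Nat.exists_eq_add_of_le hmn
      have := le_add_mul_of_le_add h2 hm t
      rw [mul_add] at *
      omega

end Converse

end CMReg

namespace CMReg

/-! ### Realization of a given defect sequence -/

section Existence

variable {k : Type u} [Field k] {d : ℕ} {a : ℕ → ℕ}

theorem exists_isDefectSequence (hd : 1 ≤ d) (h1 : ∀ n, 1 ≤ n → a (n + 1) ≤ a n)
    (h2 : ∀ n, 1 ≤ n → a n ≤ a (n + 1) + d) :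
    ∃ (R : Type u) (_ : CommRing R) (_ : Algebra k R) (𝒜 : ℕ → Submodule k R)
        (_ : GradedAlgebra 𝒜) (I : Ideal R),
      IsStandardGraded 𝒜 ∧ GeneratedInDegree 𝒜 I d ∧ I ≠ ⊤ ∧ (∀ n : ℕ, 1 ≤ n → I ^ n ≠ ⊥) ∧
      ringKrullDim (R ⧸ I) = 0 ∧ IsDefectSequence 𝒜 I d a := by
  let _ : GradedAlgebra (MvPolynomial.homogeneousSubmodule (Fin 2) k) :=
    MvPolynomial.gradedAlgebra
  let N := defectStaircase d a
  let inst : GradedAlgebra (staircaseGrading k N) :=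
    quotientGradedAlgebra _ (staircaseIdeal_isHomogeneous k N)
  have hN : ∀ {i j i' j'}, N i j → i' ≤ i → j' ≤ j → N i' j' := defectStaircase.mono
  let v := staircaseVar k N
  have hv : IsLinearGenerators (staircaseGrading k N) v := staircaseVar_isLinearGenerators k N
  have hst : IsStandardGraded (staircaseGrading k N) := ⟨2, v, hv⟩
  have hpow : ∀ (l : Fin 2) (m : ℕ), v l ^ m = Ideal.Quotient.mk (staircaseIdeal k N)
      (MvPolynomial.monomial (Finsupp.single l m) 1) := by
    intro l m
    rw [← MvPolynomial.X_pow_eq_monomial, map_pow]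
    rfl
  let I : Ideal (StaircaseAlgebra k N) := Ideal.span {v 0 ^ d}
  have hIpow : ∀ n, I ^ n = Ideal.span {v 0 ^ (d * n)} := by
    intro n
    rw [Ideal.span_singleton_pow, ← pow_mul]
  have hgen : GeneratedInDegree (staircaseGrading k N) I d := by
    refine ⟨{v 0 ^ d}, Set.singleton_subset_iff.2 ?_, rfl⟩
    simpa using SetLike.pow_mem_graded d (hv.1 0)
  have hproper : I ≠ ⊤ := by
    intro h
    have := (staircaseGrading_subset_iff k hN d 0).1 (fun y _ => by
      change y ∈ I
      rw [h]
      exact Submodule.mem_top) 0 0 rfl (Or.inl rfl)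
    omega
  have hne : ∀ n : ℕ, 1 ≤ n → I ^ n ≠ ⊥ := by
    intro n _ h
    rw [hIpow, Ideal.span_singleton_eq_bot, hpow] at h
    -- If `v 0 ^ (d * n)` were zero, it would lie in the span of the next power, although its
    -- monomial is on the bottom row of the staircase.
    have := (mk_monomial_mem_span_pow_iff k hN (d * n + 1) (Finsupp.single 0 (d * n))).1
      (h ▸ zero_mem _) (Or.inl (by simp))
    simp at this
  have hnil : ∀ l, ∃ m : ℕ, v l ^ m ∈ I := by
    intro l
    fin_cases l
    · exact ⟨d, Ideal.subset_span rfl⟩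
    -- No column of the staircase exceeds height `a 1`, the largest of the `a n`.
    · refine ⟨a 1 + 1, ?_⟩
      change v 1 ^ (a 1 + 1) ∈ I
      rw [hpow]
      refine (mk_monomial_mem_span_pow_iff k hN d _).2 fun h => ?_
      rcases h with h | ⟨n, hn, -, h⟩
      · simp at h
      · have := le_of_succ_le h1 le_rfl hn
        simp at h
        omega
  have hdim : ringKrullDim (StaircaseAlgebra k N ⧸ I) = 0 := hv.ringKrullDim_eq_zero hproper hnil
  refine ⟨StaircaseAlgebra k N, inferInstance, inferInstance, staircaseGrading k N, inst, I,
    hst, hgen, hproper, hne, hdim, fun n hn => ?_⟩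
  refine (hasRegularity_quotient_iff _ hst (I ^ n)
    (fun _ => exists_pow_mem_pow_of_ringKrullDim_eq_zero hst hgen.isHomogeneous hdim n) _).2 ?_
  have hdn : 1 ≤ d * n := Nat.mul_pos hd hn
  have hsub : ∀ m, ¬ (staircaseGrading k N m : Set (StaircaseAlgebra k N)) ⊆ (I ^ n : Ideal _) ↔
      ∃ i j, defectStaircase d a i j ∧ i < d * n ∧ i + j = m := by
    intro m
    rw [hIpow, staircaseGrading_subset_iff k hN]
    push Not
    exact exists₂_congr fun i j => by tauto
  obtain ⟨hmem, hub⟩ := isGreatest_defectStaircase hd h1 h2 hn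
  constructor
  · refine ⟨_, (hsub _).2 hmem, ?_⟩
    push_cast [hdn]
    ring
  · rintro _ ⟨m, hm, rfl⟩
    have := hub ((hsub m).1 hm)
    zify [hdn] at this
    linarith

end Existence

end CMReg

theorem theorem2p4 (k : Type u) [Field k] (d : ℕ) (hd : 1 ≤ d) (a : ℕ → ℕ) :
    (∃ (R : Type u) (_ : CommRing R) (_ : Algebra k R) (𝒜 : ℕ → Submodule k R)
        (_ : GradedAlgebra 𝒜) (I : Ideal R),
      CMReg.IsStandardGraded 𝒜 ∧
      CMReg.GeneratedInDegree 𝒜 I d ∧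
      I ≠ ⊤ ∧
      (∀ n : ℕ, 1 ≤ n → I ^ n ≠ ⊥) ∧
      ringKrullDim (R ⧸ I) = 0 ∧
      CMReg.IsDefectSequence 𝒜 I d a) ↔
    ((∀ n : ℕ, 1 ≤ n → a (n + 1) ≤ a n) ∧
      ∀ n : ℕ, 1 ≤ n → (a n : ℤ) - a (n + 1) ≤ d) := by
  constructor
  · rintro ⟨R, _, _, 𝒜, _, I, hst, hI, -, -, hdim, ha⟩
    have h := fun n (hn : 1 ≤ n) => ha.decreasing_and_le hst hd hI hdim hn
    refine ⟨fun n hn => (h n hn).1, fun n hn => ?_⟩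
    have := (h n hn).2
    omega
  · rintro ⟨h1, h2⟩
    refine CMReg.exists_isDefectSequence hd h1 fun n hn => ?_
    have := h2 n hn
    omega
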